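/- **Theorem 1.2.** Let $n \ge 1$, let $\{0,1\}^n$ be the discrete cube, viewed as a graph in which two strings are adjacent iff they differ in exactly one coordinate, and let $A \subseteq \{0,1\}^n$ be non-empty. Choose a uniformly random point $a \in A$ and let $X_0 = a, X_1, X_2, \dots$ be the simple random walk on the cube started at $a$ (at each step the walk moves to a uniformly random neighbour of its current position). Let $Y_A = \min\{k : X_k \notin A\} \in \mathbb{N} \cup \{\infty\}$ be the first exit time of the walk from $A$, and call $\mathbb{E}\, Y_A \in [0,\infty]$ the mean first exit time of $A$. Then $$\mathbb{E}\, Y_A \le \frac{n}{\log_2\left(\frac{2^n}{|A|}\right)},$$ where the right-hand side is read as $\infty$ if $A = \{0,1\}^n$. If $A$ is a subcube (the set of all points of the cube whose coordinates in some set $S \subseteq \{1,\dots,n\}$ have prescribed values), this is an equality. Consequently, subcubes maximize the mean first exit time among all subsets of the cube of the same cardinality: $\mathbb{E}\, Y_A \le \mathbb{E}\, Y_C$ for every subcube $C$ with $|C| = |A|$. -/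

import Mathlib

open MeasureTheory ProbabilityTheory
open scoped ENNReal

/-- The graph of the discrete cube `{0,1}^n`: two boolean strings are adjacent iff they differ in
exactly one coordinate. -/
def cubeGraph (n : ℕ) : SimpleGraph (Fin n → Bool) where
  Adj x y := hammingDist x y = 1
  symm := ⟨fun x y h => by rw [hammingDist_comm]; exact h⟩
  loopless := ⟨fun x h => by simp at h⟩

instance cubeGraph_decidableAdj (n : ℕ) : DecidableRel (cubeGraph n).Adj :=
  fun x y => inferInstanceAs (Decidable (hammingDist x y = 1))

/-- `A` is a subcube: it consists of all the points of the cube whose coordinates in some set `S`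
agree with those of a given point `z` (the coordinates outside `S` are free). -/
def IsSubcube {n : ℕ} (A : Finset (Fin n → Bool)) : Prop :=
  ∃ (S : Finset (Fin n)) (z : Fin n → Bool), ∀ x, x ∈ A ↔ ∀ i ∈ S, x i = z i

/-- `X` is a simple random walk on the graph `G`, started at a uniformly random vertex of `A`:
`X 0` is uniformly distributed on `A`, and, whatever the history `h 0, …, h k` up to time `k`, the
walk moves to each of the neighbours of its current position `h k` with the same probability
`1 / deg (h k)`. -/
structure IsSimpleRandomWalkFrom {V Ω : Type*} [Fintype V] [MeasurableSpace V] [MeasurableSpace Ω]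
    (G : SimpleGraph V) [DecidableRel G.Adj] (A : Finset V) (μ : Measure Ω) (X : ℕ → Ω → V) :
    Prop where
  isProbabilityMeasure : IsProbabilityMeasure μ
  measurable : ∀ k, Measurable (X k)
  map_zero : μ.map (X 0) = uniformOn (A : Set V)
  step : ∀ (k : ℕ) (h : ℕ → V) (w : V),
    μ {ω | (∀ i ≤ k, X i ω = h i) ∧ X (k + 1) ω = w} =
      μ {ω | ∀ i ≤ k, X i ω = h i} * (if G.Adj (h k) w then (G.degree (h k) : ℝ≥0∞)⁻¹ else 0)

/-- The first time at which the process `X` is outside of `A` (`⊤` if it never leaves `A`). -/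
noncomputable def firstExitTime {V Ω : Type*} (X : ℕ → Ω → V) (A : Finset V) (ω : Ω) : ℕ∞ :=
  hittingAfter X ((A : Set V)ᶜ) 0 ω

/-- The expectation (possibly `∞`) of the first exit time of `X` from `A`. -/
noncomputable def meanFirstExitTime {V Ω : Type*} [MeasurableSpace Ω] (μ : Measure Ω)
    (X : ℕ → Ω → V) (A : Finset V) : ℝ≥0∞ :=
  ∫⁻ ω, (firstExitTime X A ω : ℝ≥0∞) ∂μ

/-- Simple random walks exist on every finite graph without isolated vertices. -/
theorem exists_isSimpleRandomWalkFrom {V : Type*} [Fintype V] [MeasurableSpace V]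
    [MeasurableSingletonClass V] (G : SimpleGraph V) [DecidableRel G.Adj]
    (hG : ∀ v, (G.neighborFinset v).Nonempty) (A : Finset V) (hA : A.Nonempty) :
    ∃ (μ : Measure (ℕ → V × (V → V))) (X : ℕ → (ℕ → V × (V → V)) → V),
      IsSimpleRandomWalkFrom G A μ X := by
  classical
  have hP1 : IsProbabilityMeasure (uniformOn (A : Set V)) :=
    isProbabilityMeasure_uniformOn A.finite_toSet hA
  have hP2 : ∀ v, IsProbabilityMeasure (uniformOn (G.neighborFinset v : Set V)) := fun v =>
    isProbabilityMeasure_uniformOn (Finset.finite_toSet _) (hG v)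
  let Q : Measure (V → V) := Measure.pi fun v => uniformOn (G.neighborFinset v : Set V)
  let P : Measure (V × (V → V)) := (uniformOn (A : Set V)).prod Q
  let μ : Measure (ℕ → V × (V → V)) := Measure.infinitePi fun _ => P
  let X : ℕ → (ℕ → V × (V → V)) → V := fun k ω =>
    Nat.rec (ω 0).1 (fun j x => (ω (j + 1)).2 x) k
  have hX0 : ∀ ω, X 0 ω = (ω 0).1 := fun _ => rfl
  have hXs : ∀ k ω, X (k + 1) ω = (ω (k + 1)).2 (X k ω) := fun _ _ => rfl
  have hmap : ∀ j, μ.map (fun ω => ω j) = P := fun j => Measure.infinitePi_map_eval _ j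
  have hpr : ∀ j (S : Set (V × (V → V))), MeasurableSet S → μ {ω | ω j ∈ S} = P S := by
    intro j S hS
    rw [← hmap j, Measure.map_apply (measurable_pi_apply j) hS]
    rfl
  let m : ℕ → MeasurableSpace (ℕ → V × (V → V)) := fun j =>
    MeasurableSpace.comap (fun ω => ω j) inferInstance
  have hm : ∀ j, m j ≤ MeasurableSpace.pi := fun j => (measurable_pi_apply j).comap_le
  have hev : ∀ j, Measurable[m j] (fun ω : ℕ → V × (V → V) => ω j) := fun j =>
    comap_measurable _
  have happ : Measurable (fun p : V × (V → V) => p.2 p.1) := measurable_of_finite _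
  have hXm : ∀ k N, k ≤ N → Measurable[⨆ j ∈ Set.Iic N, m j] (X k) := by
    intro k
    induction k with
    | zero =>
      intro N _
      have h1 : m 0 ≤ ⨆ j ∈ Set.Iic N, m j := le_iSup₂_of_le 0 (Nat.zero_le N) le_rfl
      exact measurable_fst.comp ((hev 0).mono h1 le_rfl)
    | succ k ih =>
      intro N hN
      have h1 : m (k + 1) ≤ ⨆ j ∈ Set.Iic N, m j := le_iSup₂_of_le (k + 1) hN le_rfl
      exact happ.comp ((ih N (by omega)).prodMk (measurable_snd.comp ((hev (k + 1)).mono h1 le_rfl)))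
  have hle : ∀ N : ℕ, (⨆ j ∈ Set.Iic N, m j) ≤ MeasurableSpace.pi := fun N =>
    iSup₂_le fun j _ => hm j
  have hind : iIndep m μ :=
    iIndepFun_infinitePi (P := fun _ : ℕ => P) (X := fun _ p => p) (fun _ => measurable_id)
  refine ⟨μ, X, inferInstance, fun k => (hXm k k le_rfl).mono (hle k) le_rfl, ?_, ?_⟩
  · have : X 0 = Prod.fst ∘ fun ω : ℕ → V × (V → V) => ω 0 := rfl
    rw [this, ← Measure.map_map measurable_fst (measurable_pi_apply 0), hmap 0]
    simp [P]
  · intro k h w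
    have hset : {ω | (∀ i ≤ k, X i ω = h i) ∧ X (k + 1) ω = w} =
        {ω | ∀ i ≤ k, X i ω = h i} ∩ {ω | (ω (k + 1)).2 (h k) = w} := by
      ext ω
      simp only [Set.mem_ofPred_eq, Set.mem_inter_iff, hXs]
      constructor
      · rintro ⟨h1, h2⟩
        exact ⟨h1, by rw [← h1 k le_rfl]; exact h2⟩
      · rintro ⟨h1, h2⟩
        exact ⟨h1, by rw [h1 k le_rfl]; exact h2⟩
    have hdis : Disjoint (Set.Iic k) ({k + 1} : Set ℕ) := by simp
    have hI := indep_iSup_of_disjoint hm hind hdis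
    have hE : MeasurableSet[⨆ j ∈ Set.Iic k, m j] {ω | ∀ i ≤ k, X i ω = h i} := by
      have : {ω | ∀ i ≤ k, X i ω = h i} = ⋂ i ∈ Set.Iic k, X i ⁻¹' {h i} := by
        ext ω; simp
      rw [this]
      exact MeasurableSet.biInter (Set.to_countable _) fun i hi =>
        hXm i k hi (measurableSet_singleton _)
    have hF0 : MeasurableSet {p : V × (V → V) | p.2 (h k) = w} := by
      have h1 : Measurable fun p : V × (V → V) => p.2 (h k) := by fun_prop
      exact h1 (measurableSet_singleton w)
    have hF : MeasurableSet[⨆ j ∈ ({k + 1} : Set ℕ), m j] {ω | (ω (k + 1)).2 (h k) = w} := by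
      have h1 : m (k + 1) ≤ ⨆ j ∈ ({k + 1} : Set ℕ), m j :=
        le_iSup₂_of_le (k + 1) rfl le_rfl
      exact h1 _ (hev (k + 1) hF0)
    rw [hset, (Indep_iff _ _ μ).1 hI _ _ hE hF]
    congr 1
    have e1 : μ {ω | (ω (k + 1)).2 (h k) = w} = P {p | p.2 (h k) = w} :=
      hpr (k + 1) _ hF0
    have e2 : P {p | p.2 (h k) = w} = Q {q | q (h k) = w} := by
      have : {p : V × (V → V) | p.2 (h k) = w} = Set.univ ×ˢ {q | q (h k) = w} := by
        ext p; simp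
      rw [this, Measure.prod_prod]; simp
    have e3 : Q {q | q (h k) = w} = uniformOn (G.neighborFinset (h k) : Set V) {w} := by
      have := measurePreserving_eval (fun v => uniformOn (G.neighborFinset v : Set V)) (h k)
      rw [← this.map_eq, Measure.map_apply this.measurable (measurableSet_singleton w)]
      rfl
    rw [e1, e2, e3, ← Finset.coe_singleton, uniformOn_apply_finset]
    by_cases hw : G.Adj (h k) w
    · simp [hw]
    · have : G.neighborFinset (h k) ∩ {w} = ∅ := by
        ext x; simp; rintro h1 rfl; exact hw h1
      rw [this]; simp [hw]

/-- On the cube of positive dimension there is a simple random walk from every non-empty set. -/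
theorem exists_isSimpleRandomWalkFrom_cubeGraph {n : ℕ} (hn : 1 ≤ n)
    (A : Finset (Fin n → Bool)) (hA : A.Nonempty) :
    ∃ (Ω : Type) (_ : MeasurableSpace Ω) (μ : Measure Ω) (X : ℕ → Ω → (Fin n → Bool)),
      IsSimpleRandomWalkFrom (cubeGraph n) A μ X := by
  have hG : ∀ v, ((cubeGraph n).neighborFinset v).Nonempty := by
    intro v
    refine ⟨Function.update v ⟨0, hn⟩ (!v ⟨0, hn⟩), ?_⟩
    rw [SimpleGraph.mem_neighborFinset]
    change hammingDist _ _ = 1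
    unfold hammingDist
    rw [Finset.card_eq_one]
    refine ⟨⟨0, hn⟩, ?_⟩
    ext i
    by_cases hi : i = ⟨0, hn⟩
    · subst hi; simp
    · simp [hi]
  obtain ⟨μ, X, h⟩ := exists_isSimpleRandomWalkFrom (cubeGraph n) hG A hA
  exact ⟨_, _, μ, X, h⟩

/-! Let `u x` be the expected number of visits to `x` before the walk leaves `A`, counted over the
times `k < N`. Then `∑ x, u x` increases to the mean exit time as `N` grows. Since `u` vanishes off
`A` and satisfies `n * u x - ∑ i, u (flipCoord i x) ≤ n / A.card` on `A`, summation by parts bounds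
its energy by `2 * (∑ x, u x) * n / A.card`. The energy is also at least quadratic in `∑ x, u x` by
`sq_sum_mul_le_edgeEnergy`; cancelling one factor `∑ x, u x` gives the bound
(`sum_killed_walk_mul_le`).

The energy inequality goes by induction on `n`. The two slices of `f` are replaced by their
pointwise maximum and minimum, which does not increase the energy inside the slices, keeps the
energy between them, and makes the supports nested. What remains is an inequality in two sums and
two cardinalities, `slice_inequality`.

In a subcube with fixed coordinates `S`, each step survives with probability `1 - S.card / n`
wherever the walk is, so the exit time is geometric with mean `n / S.card`, and `S.card` is the
logarithm in the bound. -/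

/-! ### Numerical inequalities -/

/-- A two-point inequality behind the induction on the dimension of the cube. -/
theorem two_point_inequality {a b r : ℝ} (hr0 : 0 < r) (hr1 : r ≤ 1) :
    (a + b) ^ 2 * (1 - Real.logb 2 (1 + r)) / (1 + r) ≤
      b ^ 2 * (-Real.logb 2 r) / r + (a - b) ^ 2 := by
  set K := 1 - Real.logb 2 (1 + r) with hK
  have hK0 : 0 ≤ K := by
    have : Real.logb 2 (1 + r) ≤ Real.logb 2 2 :=
      Real.logb_le_logb_of_le (by norm_num) (by positivity) (by linarith)
    rw [Real.logb_self_eq_one (by norm_num)] at this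
    linarith
  -- Bernoulli: `2 ^ r ≤ 1 + r` for `r` in `[0, 1]`.
  have hK1 : K ≤ 1 - r := by
    have h1 : (2 : ℝ) ^ r ≤ 1 + r := by
      have := rpow_one_add_le_one_add_mul_self (s := 1) (by norm_num) hr0.le hr1
      norm_num at this
      exact this
    have := (Real.le_logb_iff_rpow_le (b := 2) (by norm_num) (by positivity : 0 < 1 + r)).2 h1
    linarith
  -- AM-GM in the form `4 * r ≤ (1 + r) ^ 2`.
  have hL : 2 * K ≤ -Real.logb 2 r := by
    have h1 : Real.logb 2 (4 * r) ≤ Real.logb 2 ((1 + r) ^ 2) :=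
      Real.logb_le_logb_of_le (by norm_num) (by positivity) (by nlinarith [sq_nonneg (1 - r)])
    rw [Real.logb_mul (by norm_num) hr0.ne', Real.logb_pow,
      show (4 : ℝ) = 2 ^ 2 by norm_num, Real.logb_pow, Real.logb_self_eq_one (by norm_num)] at h1
    push_cast at h1
    linarith
  have h2 : b ^ 2 * (2 * K) / r ≤ b ^ 2 * (-Real.logb 2 r) / r := by gcongr
  refine le_trans ?_ (add_le_add_left h2 _)
  rw [div_add' _ _ _ hr0.ne', div_le_div_iff₀ (by positivity) hr0]
  -- With denominators cleared, `1 - r` times the difference of the two sides is exactly the sum of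
  -- the expressions in `hb` and `hc`. At `r = 1` this is void, but there `K = 0`.
  have hb : 0 ≤ (1 - r - K) * (r * (1 + r) * (a - b) ^ 2) := by
    have : 0 ≤ 1 - r - K := by linarith
    positivity
  have hc : 0 ≤ K * (2 * (r * a - b) ^ 2) := by positivity
  rcases hr1.lt_or_eq with h | rfl
  · have h3 : 0 < 1 - r := by linarith
    refine le_of_mul_le_mul_left ?_ h3
    nlinarith
  · have : K = 0 := by linarith
    rw [this]; nlinarith [sq_nonneg (a - b)]

/-- The numerical inequality that combines the bounds for the two slices of a function on the
cube. -/
theorem slice_inequality {n : ℕ} {a b : ℝ} {α β : ℕ} (hα : 0 < α) (hαn : α ≤ 2 ^ n)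
    (hβα : β ≤ α) (hb : β = 0 → b = 0) :
    (a + b) ^ 2 * ((n + 1 : ℕ) - Real.logb 2 (α + β : ℕ)) / (α + β : ℕ) ≤
      a ^ 2 * (n - Real.logb 2 α) / α + b ^ 2 * (n - Real.logb 2 β) / β + (a - b) ^ 2 / α := by
  have hα' : (0 : ℝ) < α := by exact_mod_cast hα
  rcases Nat.eq_zero_or_pos β with h0 | h0
  · rw [hb h0, h0]
    push_cast
    simp only [add_zero, sub_zero]
    apply le_of_eq
    ring
  have hβ' : (0 : ℝ) < β := by exact_mod_cast h0
  have hl : 0 ≤ (n : ℝ) - Real.logb 2 α := by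
    have : Real.logb 2 α ≤ Real.logb 2 (2 ^ n) :=
      Real.logb_le_logb_of_le (by norm_num) hα' (by exact_mod_cast hαn)
    rw [Real.logb_pow, Real.logb_self_eq_one (by norm_num)] at this
    linarith
  obtain ⟨r, hr⟩ : ∃ r : ℝ, r = β / α := ⟨_, rfl⟩
  have hβr : (β : ℝ) = α * r := by rw [hr]; field_simp
  have hr0 : 0 < r := by rw [hr]; positivity
  have hr1 : r ≤ 1 := by rw [hr, div_le_one hα']; exact_mod_cast hβα
  have key := two_point_inequality (a := a) (b := b) hr0 hr1
  push_cast
  rw [hβr, show (α : ℝ) + α * r = α * (1 + r) by ring,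
    Real.logb_mul hα'.ne' hr0.ne', Real.logb_mul hα'.ne' (by positivity)]
  -- After scaling by `α`, the inequality is the sum of this Cauchy–Schwarz bound, weighted by `n -
  -- Real.logb 2 α ≥ 0`, and the two-point inequality.
  have hcs : (a + b) ^ 2 / (1 + r) ≤ a ^ 2 + b ^ 2 / r := by
    rw [add_div' _ _ _ hr0.ne', div_le_div_iff₀ (by positivity) hr0]
    nlinarith [sq_nonneg (r * a - b)]
  have h1 := mul_le_mul_of_nonneg_right hcs hl
  have h2 := div_le_div_of_nonneg_right (add_le_add h1 key) hα'.le
  refine (le_of_eq ?_).trans (h2.trans (le_of_eq ?_))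
  · field_simp
    ring
  · field_simp
    ring

/-! ### Edge energy and the functional isoperimetric inequality -/

/-- The neighbour of a vertex of the cube in a given direction. -/
def flipCoord {n : ℕ} (i : Fin n) (x : Fin n → Bool) : Fin n → Bool :=
  Function.update x i (!x i)

theorem flipCoord_flipCoord {n : ℕ} (i : Fin n) (x : Fin n → Bool) :
    flipCoord i (flipCoord i x) = x := by
  simp [flipCoord]

theorem flipCoord_succ_cons {n : ℕ} (i : Fin n) (b : Bool) (x : Fin n → Bool) :
    flipCoord i.succ (Fin.cons b x : Fin (n + 1) → Bool) = Fin.cons b (flipCoord i x) := by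
  simp [flipCoord, Fin.cons_update]

theorem flipCoord_zero_cons {n : ℕ} (b : Bool) (x : Fin n → Bool) :
    flipCoord 0 (Fin.cons b x : Fin (n + 1) → Bool) = Fin.cons (!b) x := by
  simp [flipCoord, Fin.update_cons_zero]

theorem sum_comp_flipCoord {n : ℕ} {M : Type*} [AddCommMonoid M] (i : Fin n)
    (f : (Fin n → Bool) → M) : ∑ x, f (flipCoord i x) = ∑ x, f x :=
  Equiv.sum_comp ⟨flipCoord i, flipCoord i, flipCoord_flipCoord i, flipCoord_flipCoord i⟩ f

theorem sum_cube_succ {n : ℕ} {M : Type*} [AddCommMonoid M] (f : (Fin (n + 1) → Bool) → M) :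
    ∑ x, f x = ∑ x : Fin n → Bool, f (Fin.cons true x) +
      ∑ x : Fin n → Bool, f (Fin.cons false x) := by
  rw [← Equiv.sum_comp (Fin.consEquiv fun _ => Bool) f, Fintype.sum_prod_type]
  simp [Fin.consEquiv]

/-- The sum of the squared increments of a function over the directed edges of the cube. -/
def edgeEnergy {n : ℕ} (f : (Fin n → Bool) → ℝ) : ℝ :=
  ∑ i, ∑ x, (f x - f (flipCoord i x)) ^ 2

/-- The factor 2 arises because each edge between the slices is seen from both ends. -/
theorem edgeEnergy_succ {n : ℕ} (f : (Fin (n + 1) → Bool) → ℝ) :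
    edgeEnergy f = edgeEnergy (fun x => f (Fin.cons true x)) +
      edgeEnergy (fun x => f (Fin.cons false x)) +
      2 * ∑ x : Fin n → Bool, (f (Fin.cons true x) - f (Fin.cons false x)) ^ 2 := by
  simp only [edgeEnergy, Fin.sum_univ_succ, sum_cube_succ, flipCoord_succ_cons,
    flipCoord_zero_cons, Finset.sum_add_distrib, Bool.not_true, Bool.not_false]
  have : ∑ x : Fin n → Bool, (f (Fin.cons false x) - f (Fin.cons true x)) ^ 2 =
      ∑ x : Fin n → Bool, (f (Fin.cons true x) - f (Fin.cons false x)) ^ 2 :=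
    Finset.sum_congr rfl fun x _ => by ring
  rw [this]; ring

/-- If the two pairs are ordered alike, this is an equality; if oppositely, the two sides differ by
twice the product of the gaps `|p - q|` and `|r - s|`. -/
theorem sq_max_sub_max_add_sq_min_sub_min_le (p q r s : ℝ) :
    (max p q - max r s) ^ 2 + (min p q - min r s) ^ 2 ≤ (p - r) ^ 2 + (q - s) ^ 2 := by
  rcases le_total p q with h | h <;> rcases le_total r s with h' | h' <;>
    simp only [max_eq_left, max_eq_right, min_eq_left, min_eq_right, h, h'] <;>
    nlinarith [mul_nonneg (sub_nonneg.2 h) (sub_nonneg.2 h')]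

theorem edgeEnergy_max_add_min_le {n : ℕ} (f g : (Fin n → Bool) → ℝ) :
    edgeEnergy (fun x => max (f x) (g x)) + edgeEnergy (fun x => min (f x) (g x)) ≤
      edgeEnergy f + edgeEnergy g := by
  simp only [edgeEnergy, ← Finset.sum_add_distrib]
  exact Finset.sum_le_sum fun i _ => Finset.sum_le_sum fun x _ =>
    sq_max_sub_max_add_sq_min_sub_min_le _ _ _ _

theorem sq_sum_le_card_mul_sum_sq_of_support {ι : Type*} [Fintype ι] (A : Finset ι) (f : ι → ℝ)
    (hf : ∀ x ∉ A, f x = 0) : (∑ x, f x) ^ 2 ≤ A.card * ∑ x, f x ^ 2 := by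
  rw [← Finset.sum_subset A.subset_univ fun x _ h => hf x h,
    ← Finset.sum_subset A.subset_univ fun x _ h => by simp [hf x h]]
  exact sq_sum_le_card_mul_sum_sq

theorem card_cube_le {n : ℕ} (A : Finset (Fin n → Bool)) : A.card ≤ 2 ^ n :=
  A.card_le_univ.trans (by simp)

/-- A sharp functional edge-isoperimetric inequality: a lower bound for the energy of a
nonnegative function on the cube in terms of its sum and of the size of its support. -/
theorem sq_sum_mul_le_edgeEnergy {n : ℕ} (A : Finset (Fin n → Bool)) (f : (Fin n → Bool) → ℝ)
    (h0 : ∀ x, 0 ≤ f x) (hf : ∀ x ∉ A, f x = 0) :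
    2 * ((∑ x, f x) ^ 2 * (n - Real.logb 2 A.card) / A.card) ≤ edgeEnergy f := by
  induction n with
  | zero =>
    have h1 : (A.card : ℝ) = 0 ∨ (A.card : ℝ) = 1 := by
      have := card_cube_le A
      have : A.card = 0 ∨ A.card = 1 := by omega
      exact_mod_cast this
    rcases h1 with h1 | h1 <;> simp [h1, edgeEnergy]
  | succ n ih =>
    rcases A.eq_empty_or_nonempty with rfl | hA
    · simp only [Finset.card_empty, Nat.cast_zero, div_zero, mul_zero]
      exact Finset.sum_nonneg fun i _ => Finset.sum_nonneg fun x _ => sq_nonneg _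
    set f₁ : (Fin n → Bool) → ℝ := fun x => f (Fin.cons true x) with hf₁
    set f₀ : (Fin n → Bool) → ℝ := fun x => f (Fin.cons false x) with hf₀
    let A₁ : Finset (Fin n → Bool) := {x | (Fin.cons true x : Fin (n + 1) → Bool) ∈ A}
    let A₀ : Finset (Fin n → Bool) := {x | (Fin.cons false x : Fin (n + 1) → Bool) ∈ A}
    have hcard : A.card = (A₁ ∪ A₀).card + (A₁ ∩ A₀).card := by
      rw [Finset.card_union_add_card_inter, Finset.card_filter, Finset.card_filter,
        ← sum_cube_succ fun x => if x ∈ A then 1 else 0]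
      simp
    have hz₁ : ∀ x ∉ A₁, f₁ x = 0 := fun x hx => hf _ (by simpa [A₁] using hx)
    have hz₀ : ∀ x ∉ A₀, f₀ x = 0 := fun x hx => hf _ (by simpa [A₀] using hx)
    have hmax : ∀ x ∉ A₁ ∪ A₀, max (f₁ x) (f₀ x) = 0 := by
      intro x hx
      rw [Finset.mem_union, not_or] at hx
      simp [hz₁ x hx.1, hz₀ x hx.2]
    have hmin : ∀ x ∉ A₁ ∩ A₀, min (f₁ x) (f₀ x) = 0 := by
      intro x hx
      rw [Finset.mem_inter, not_and_or] at hx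
      rcases hx with hx | hx
      · rw [hz₁ x hx]; exact min_eq_left (h0 _)
      · rw [hz₀ x hx]; exact min_eq_right (h0 _)
    have i₁ := ih (A₁ ∪ A₀) (fun x => max (f₁ x) (f₀ x)) (fun x => le_max_of_le_left (h0 _)) hmax
    have i₀ := ih (A₁ ∩ A₀) (fun x => min (f₁ x) (f₀ x)) (fun x => le_min (h0 _) (h0 _)) hmin
    have hE := edgeEnergy_max_add_min_le f₁ f₀
    have hle : (A₁ ∩ A₀).card ≤ (A₁ ∪ A₀).card :=
      Finset.card_le_card Finset.inter_subset_union
    have hpos : 0 < (A₁ ∪ A₀).card := by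
      have := hA.card_pos
      omega
    have hd : ∑ x, (f₁ x - f₀ x) ^ 2 = ∑ x, (max (f₁ x) (f₀ x) - min (f₁ x) (f₀ x)) ^ 2 :=
      Finset.sum_congr rfl fun x _ => by rw [max_sub_min_eq_abs, sq_abs]; ring
    have hs : ∑ x, f x = ∑ x, max (f₁ x) (f₀ x) + ∑ x, min (f₁ x) (f₀ x) := by
      rw [sum_cube_succ, ← Finset.sum_add_distrib, ← Finset.sum_add_distrib]
      exact Finset.sum_congr rfl fun x _ => (max_add_min _ _).symm
    -- Cauchy–Schwarz on the union of the supports; passing to maximum and minimum preserves `|f₁ -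
    -- f₀|`.
    have hdiff : (∑ x, max (f₁ x) (f₀ x) - ∑ x, min (f₁ x) (f₀ x)) ^ 2 / (A₁ ∪ A₀).card ≤
        ∑ x, (f₁ x - f₀ x) ^ 2 := by
      rw [div_le_iff₀' (by exact_mod_cast hpos), hd, ← Finset.sum_sub_distrib]
      refine sq_sum_le_card_mul_sum_sq_of_support _ _ fun x hx => ?_
      rw [hmax x hx, hmin x fun h => hx (Finset.inter_subset_union h), sub_zero]
    have hb : (A₁ ∩ A₀).card = 0 → ∑ x, min (f₁ x) (f₀ x) = 0 := fun h =>
      Finset.sum_eq_zero fun x _ => hmin x (by rw [Finset.card_eq_zero.1 h]; simp)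
    have key := slice_inequality (n := n) (a := ∑ x, max (f₁ x) (f₀ x)) hpos
      (card_cube_le _) hle hb
    rw [edgeEnergy_succ, hs, hcard]
    linarith

/-! ### The walk killed outside `A` -/

theorem sum_flipCoord_eq_sum_adj {n : ℕ} {M : Type*} [AddCommMonoid M] (x : Fin n → Bool)
    (f : (Fin n → Bool) → M) :
    ∑ w, (if (cubeGraph n).Adj x w then f w else 0) = ∑ i, f (flipCoord i x) := by
  have hinj : Function.Injective fun i : Fin n => flipCoord i x := by
    intro i j hij
    by_contra hne
    have := congrFun hij i
    simp [flipCoord, Function.update_of_ne hne] at this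
  rw [← Finset.sum_image (g := fun i => flipCoord i x) fun i _ j _ h => hinj h,
    ← Finset.sum_filter]
  refine Finset.sum_congr ?_ fun _ _ => rfl
  ext w
  simp only [Finset.mem_filter, Finset.mem_univ, true_and, Finset.mem_image]
  change hammingDist x w = 1 ↔ _
  unfold hammingDist
  rw [Finset.card_eq_one]
  constructor
  · rintro ⟨i, hi⟩
    have h : ∀ j, x j ≠ w j ↔ j = i := fun j => by
      have := Finset.ext_iff.1 hi j
      simpa using this
    refine ⟨i, funext fun j => ?_⟩
    by_cases hj : j = i
    · subst hj
      have := (h j).2 rfl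
      simp only [flipCoord, Function.update_self]
      revert this
      cases x j <;> cases w j <;> simp
    · have := (h j).not.2 hj
      rw [flipCoord, Function.update_of_ne hj]
      exact not_not.1 this
  · rintro ⟨i, rfl⟩
    refine ⟨i, Finset.ext fun j => ?_⟩
    rw [Finset.mem_filter, Finset.mem_singleton]
    by_cases hj : j = i
    · subst hj; simp [flipCoord]
    · simp [flipCoord, hj]

theorem cubeGraph_degree {n : ℕ} (x : Fin n → Bool) : (cubeGraph n).degree x = n := by
  have := sum_flipCoord_eq_sum_adj x fun _ => 1
  rw [← SimpleGraph.card_neighborFinset_eq_degree, SimpleGraph.neighborFinset_eq_filter,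
    Finset.card_filter, this]
  simp

/-- An upper bound for the sums of a sequence of functions on the cube that evolves by the walk killed outside of `A`,
starting from the uniform distribution on `A`. -/
theorem sum_killed_walk_mul_le {n : ℕ} (hn : 0 < n) {A : Finset (Fin n → Bool)} (hA : A.Nonempty)
    (m : ℕ → (Fin n → Bool) → ℝ) (hm : ∀ k x, 0 ≤ m k x)
    (h0 : ∀ x, m 0 x = if x ∈ A then (A.card : ℝ)⁻¹ else 0)
    (hs : ∀ k x, m (k + 1) x = if x ∈ A then (n : ℝ)⁻¹ * ∑ i, m k (flipCoord i x) else 0)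
    (N : ℕ) :
    (∑ k ∈ Finset.range N, ∑ x, m k x) * (n - Real.logb 2 A.card) ≤ n := by
  have hn' : (0 : ℝ) < n := by exact_mod_cast hn
  have hA' : (0 : ℝ) < A.card := by exact_mod_cast hA.card_pos
  obtain ⟨u, hu⟩ : ∃ u : (Fin n → Bool) → ℝ, ∀ x, u x = ∑ k ∈ Finset.range N, m k x :=
    ⟨_, fun _ => rfl⟩
  have hu0 : ∀ x, 0 ≤ u x := fun x => by rw [hu]; exact Finset.sum_nonneg fun k _ => hm k x
  have huA : ∀ x ∉ A, u x = 0 := fun x hx => by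
    rw [hu]
    refine Finset.sum_eq_zero fun k _ => ?_
    cases k with
    | zero => rw [h0, if_neg hx]
    | succ k => rw [hs, if_neg hx]
  have hlap : ∀ x ∈ A, n * u x - ∑ i, u (flipCoord i x) ≤ n / A.card := by
    intro x hx
    -- The sum of `m k x` over `k ≤ N`, split off at its last term and at its first. Dropping `m N x
    -- ≥ 0` then gives `hlap`.
    have h1 : u x + m N x = (A.card : ℝ)⁻¹ + (n : ℝ)⁻¹ * ∑ i, u (flipCoord i x) := by
      rw [hu, ← Finset.sum_range_succ, Finset.sum_range_succ', h0, if_pos hx, add_comm]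
      simp only [hu, hs, if_pos hx]
      rw [Finset.sum_comm, Finset.mul_sum]
    have h2 : n * u x + n * m N x = n / A.card + ∑ i, u (flipCoord i x) := by
      rw [← mul_add, h1]; field_simp
    have := mul_nonneg hn'.le (hm N x)
    linarith
  have hE : edgeEnergy u = 2 * ∑ x, u x * (n * u x - ∑ i, u (flipCoord i x)) := by
    -- Expand the square; `flipCoord i` permutes the cube, so both square terms have the same sum.
    have h1 : ∀ i : Fin n, ∑ x, (u x - u (flipCoord i x)) ^ 2 =
        2 * ∑ x, (u x ^ 2 - u x * u (flipCoord i x)) := by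
      intro i
      have h2 := sum_comp_flipCoord i fun x => u x ^ 2
      rw [Finset.sum_sub_distrib, mul_sub, two_mul]
      nth_rewrite 2 [← h2]
      rw [Finset.mul_sum, ← Finset.sum_add_distrib, ← Finset.sum_sub_distrib]
      exact Finset.sum_congr rfl fun x _ => by ring
    rw [edgeEnergy, Finset.sum_congr rfl fun i _ => h1 i, ← Finset.mul_sum, Finset.sum_comm]
    congr 1
    refine Finset.sum_congr rfl fun x _ => ?_
    rw [Finset.sum_sub_distrib, ← Finset.mul_sum]
    simp
    ring
  have hE' : edgeEnergy u ≤ 2 * ((∑ x, u x) * (n / A.card)) := by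
    rw [hE, Finset.sum_mul]
    refine mul_le_mul_of_nonneg_left (Finset.sum_le_sum fun x _ => ?_) zero_le_two
    by_cases hx : x ∈ A
    · exact mul_le_mul_of_nonneg_left (hlap x hx) (hu0 x)
    · simp [huA x hx]
  have hI := (sq_sum_mul_le_edgeEnergy A u hu0 huA).trans hE'
  rw [Finset.sum_comm, ← Finset.sum_congr rfl fun x _ => hu x]
  rcases (Finset.sum_nonneg fun x _ => hu0 x : 0 ≤ ∑ x, u x).eq_or_lt with h | h
  · rw [← h, zero_mul]; exact hn'.le
  · rw [mul_le_mul_iff_right₀ zero_lt_two, mul_div_assoc', div_le_div_iff_of_pos_right hA', sq,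
      mul_assoc] at hI
    exact le_of_mul_le_mul_left hI h

/-! ### The mean exit time as a sum of survival probabilities -/

theorem ENat.toENNReal_eq_tsum (m : ℕ∞) :
    (m : ℝ≥0∞) = ∑' k : ℕ, if (k : ℕ∞) < m then 1 else 0 := by
  induction m using ENat.recTopCoe with
  | top => simp
  | coe m =>
    rw [tsum_eq_sum (s := Finset.range m) fun k hk => by simpa using hk]
    rw [Finset.sum_congr rfl fun k hk => if_pos (by simpa using hk)]
    simp

theorem lt_firstExitTime_iff {V Ω : Type*} (X : ℕ → Ω → V) (A : Finset V) (ω : Ω) (k : ℕ) :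
    (k : ℕ∞) < firstExitTime X A ω ↔ ∀ i ≤ k, X i ω ∈ A := by
  constructor
  · intro h i hi
    have h1 : (i : WithTop ℕ) < hittingAfter X ((A : Set V)ᶜ) 0 ω :=
      lt_of_le_of_lt (WithTop.coe_le_coe.2 hi) h
    simpa using notMem_of_lt_hittingAfter h1 (Nat.zero_le i)
  · intro h
    unfold firstExitTime
    rw [hittingAfter_def]
    dsimp only
    split_ifs with hex
    · have hmem := Nat.sInf_mem (s := {i : ℕ | 0 ≤ i ∧ X i ω ∈ (A : Set V)ᶜ}) hex
      have : k < sInf {i : ℕ | 0 ≤ i ∧ X i ω ∈ (A : Set V)ᶜ} := by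
        by_contra! hle
        exact hmem.2 (h _ hle)
      exact WithTop.coe_lt_coe.2 this
    · exact ENat.natCast_lt_top k

theorem meanFirstExitTime_eq_tsum {V Ω : Type*} [MeasurableSpace V] [MeasurableSingletonClass V]
    [MeasurableSpace Ω] (μ : Measure Ω) (X : ℕ → Ω → V) (hX : ∀ k, Measurable (X k))
    (A : Finset V) :
    meanFirstExitTime μ X A = ∑' k, μ {ω | ∀ i ≤ k, X i ω ∈ A} := by
  have hmeas : ∀ k, MeasurableSet {ω | ∀ i ≤ k, X i ω ∈ A} := fun k => by
    have : {ω | ∀ i ≤ k, X i ω ∈ A} = ⋂ i ∈ Set.Iic k, X i ⁻¹' A := by ext; simp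
    rw [this]
    exact MeasurableSet.biInter (Set.to_countable _) fun i _ => hX i A.measurableSet
  have h1 : ∀ ω, (firstExitTime X A ω : ℝ≥0∞) =
      ∑' k, {ω | ∀ i ≤ k, X i ω ∈ A}.indicator 1 ω := fun ω => by
    rw [ENat.toENNReal_eq_tsum]
    refine tsum_congr fun k => ?_
    by_cases h : ∀ i ≤ k, X i ω ∈ A
    · rw [if_pos ((lt_firstExitTime_iff X A ω k).2 h), Set.indicator_of_mem (by exact h)]
      rfl
    · rw [if_neg fun h' => h ((lt_firstExitTime_iff X A ω k).1 h'), 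
        Set.indicator_of_notMem (by exact h)]
  rw [meanFirstExitTime, lintegral_congr h1,
    lintegral_tsum fun k => (measurable_one.indicator (hmeas k)).aemeasurable]
  exact tsum_congr fun k => lintegral_indicator_one (hmeas k)

/-! ### Markov property of the killed walk -/

/-- The probability that the process `X` stays in `A` up to time `k`, when it is at `x`. -/
noncomputable def survivalAt {V Ω : Type*} [MeasurableSpace Ω] (μ : Measure Ω) (X : ℕ → Ω → V)
    (A : Finset V) (k : ℕ) (x : V) : ℝ≥0∞ :=
  μ {ω | (∀ i ≤ k, X i ω ∈ A) ∧ X k ω = x}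

theorem survivalAt_eq_zero {V Ω : Type*} [MeasurableSpace Ω] {μ : Measure Ω}
    {X : ℕ → Ω → V} {A : Finset V} {k : ℕ} {x : V} (hx : x ∉ A) : survivalAt μ X A k x = 0 := by
  have : {ω | (∀ i ≤ k, X i ω ∈ A) ∧ X k ω = x} = ∅ := by
    ext ω
    simp only [Set.mem_ofPred_eq, Set.mem_empty_iff_false, iff_false, not_and]
    rintro h rfl
    exact hx (h k le_rfl)
  rw [survivalAt, this, measure_empty]

section

variable {V Ω : Type*} [Fintype V] [MeasurableSpace V] [MeasurableSpace Ω]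
  {G : SimpleGraph V} [DecidableRel G.Adj]
  {A : Finset V} {μ : Measure Ω} {X : ℕ → Ω → V}

/-- `uniformOn ∅` is the zero measure, so it is not the law of `X 0`. -/
theorem IsSimpleRandomWalkFrom.nonempty (hX : IsSimpleRandomWalkFrom G A μ X) : A.Nonempty := by
  by_contra h
  rw [Finset.not_nonempty_iff_eq_empty] at h
  have := hX.isProbabilityMeasure
  have h1 : (μ.map (X 0)) Set.univ = 1 := by
    rw [Measure.map_apply (hX.measurable 0) MeasurableSet.univ]; simp
  rw [hX.map_zero, h] at h1
  simp at h1

variable [MeasurableSingletonClass V]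

theorem IsSimpleRandomWalkFrom.sum_survivalAt (hX : IsSimpleRandomWalkFrom G A μ X) (k : ℕ) :
    ∑ x, survivalAt μ X A k x = μ {ω | ∀ i ≤ k, X i ω ∈ A} := by
  rw [← Measure.restrict_apply_univ {ω | ∀ i ≤ k, X i ω ∈ A}, ← Set.preimage_univ (f := X k),
    ← Finset.coe_univ,
    ← sum_measure_preimage_singleton _ fun x _ => hX.measurable k (measurableSet_singleton x)]
  refine Finset.sum_congr rfl fun x _ => ?_
  rw [Measure.restrict_apply (hX.measurable k (measurableSet_singleton x)), Set.inter_comm]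
  rfl

variable [DecidableEq V]

theorem IsSimpleRandomWalkFrom.survivalAt_zero (hX : IsSimpleRandomWalkFrom G A μ X) (x : V) :
    survivalAt μ X A 0 x = if x ∈ A then (A.card : ℝ≥0∞)⁻¹ else 0 := by
  split_ifs with hx
  · have h1 : {ω | (∀ i ≤ 0, X i ω ∈ A) ∧ X 0 ω = x} = X 0 ⁻¹' {x} := by
      ext ω
      simp only [Nat.le_zero, forall_eq, Set.mem_ofPred_eq, Set.mem_preimage,
        Set.mem_singleton_iff, and_iff_right_iff_imp]
      rintro rfl
      exact hx
    rw [survivalAt, h1, ← Measure.map_apply (hX.measurable 0) (measurableSet_singleton x),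
      hX.map_zero, ← Finset.coe_singleton, uniformOn_apply_finset,
      Finset.inter_singleton_of_mem hx]
    simp
  · exact survivalAt_eq_zero hx

/-- The Markov property for the walk that is killed when it leaves `A`. -/
theorem IsSimpleRandomWalkFrom.measure_survival_step (hX : IsSimpleRandomWalkFrom G A μ X)
    (k : ℕ) (x w : V) :
    μ {ω | ((∀ i ≤ k, X i ω ∈ A) ∧ X k ω = x) ∧ X (k + 1) ω = w} =
      survivalAt μ X A k x * (if G.Adj x w then (G.degree x : ℝ≥0∞)⁻¹ else 0) := by
  let T : Ω → Fin (k + 1) → V := fun ω i => X i ω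
  have hT : Measurable T := measurable_pi_lambda _ fun i => hX.measurable i
  let S : Finset (Fin (k + 1) → V) := {g | (∀ i, g i ∈ A) ∧ g (Fin.last k) = x}
  have hS : {ω | (∀ i ≤ k, X i ω ∈ A) ∧ X k ω = x} = T ⁻¹' S := by
    ext ω
    simp only [S, T, Set.mem_ofPred_eq, Set.mem_preimage, Finset.coe_filter, Finset.mem_univ,
      true_and, Fin.val_last]
    refine and_congr_left fun _ => ⟨fun h i => h i (by omega), fun h i hi => h ⟨i, by omega⟩⟩
  have hw : MeasurableSet {ω | X (k + 1) ω = w} :=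
    hX.measurable (k + 1) (measurableSet_singleton w)
  have hfib : ∀ g, MeasurableSet (T ⁻¹' {g}) := fun g => hT (measurableSet_singleton g)
  have hset : {ω | ((∀ i ≤ k, X i ω ∈ A) ∧ X k ω = x) ∧ X (k + 1) ω = w} =
      T ⁻¹' S ∩ {ω | X (k + 1) ω = w} := by
    rw [← hS]; rfl
  -- The step law is given for complete histories only, so both events are split over the finitely
  -- many histories that stay in `A` and end at `x`.
  rw [survivalAt, hS, hset, ← Measure.restrict_apply' hw,
    ← sum_measure_preimage_singleton S fun g _ => hfib g,
    ← sum_measure_preimage_singleton S fun g _ => hfib g, Finset.sum_mul]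
  refine Finset.sum_congr rfl fun g hg => ?_
  have hgx : g (Fin.last k) = x := by
    simp only [S, Finset.mem_filter] at hg
    exact hg.2.2
  -- The values beyond time `k` are arbitrary, as the step law at `k` ignores them.
  let h : ℕ → V := fun i => if hi : i < k + 1 then g ⟨i, hi⟩ else x
  have hhk : h k = x := by
    simp only [h, lt_add_one, dif_pos]
    exact hgx
  have hfg : T ⁻¹' {g} = {ω | ∀ i ≤ k, X i ω = h i} := by
    ext ω
    simp only [Set.mem_preimage, Set.mem_singleton_iff, funext_iff, T, Set.mem_ofPred_eq]
    constructor
    · intro H i hi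
      have hi' : i < k + 1 := by omega
      simp only [h, dif_pos hi']
      exact H ⟨i, hi'⟩
    · intro H i
      have := H i (by omega)
      simpa only [h, dif_pos i.2] using this
  have := hX.step k h w
  rw [hhk] at this
  rw [Measure.restrict_apply' hw, hfg, ← this]
  rfl

theorem IsSimpleRandomWalkFrom.survivalAt_succ (hX : IsSimpleRandomWalkFrom G A μ X)
    (k : ℕ) (w : V) :
    survivalAt μ X A (k + 1) w = if w ∈ A then
      ∑ x, survivalAt μ X A k x * (if G.Adj x w then (G.degree x : ℝ≥0∞)⁻¹ else 0) else 0 := by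
  split_ifs with hw
  · simp only [← hX.measure_survival_step]
    have hset : {ω | (∀ i ≤ k + 1, X i ω ∈ A) ∧ X (k + 1) ω = w} =
        {ω | (∀ i ≤ k, X i ω ∈ A) ∧ X (k + 1) ω = w} := by
      ext ω
      refine and_congr_left fun h => ⟨fun H i hi => H i (by omega), fun H i hi => ?_⟩
      rcases Nat.le_succ_iff.1 hi with hi | rfl
      · exact H i hi
      · rw [Nat.succ_eq_add_one, h]; exact hw
    rw [survivalAt, hset, ← Measure.restrict_apply_univ,
      ← Set.preimage_univ (f := X k), ← Finset.coe_univ,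
      ← sum_measure_preimage_singleton _ fun x _ => hX.measurable k (measurableSet_singleton x)]
    refine Finset.sum_congr rfl fun x _ => ?_
    rw [Measure.restrict_apply (hX.measurable k (measurableSet_singleton x))]
    congr 1
    ext ω
    simp only [Set.mem_inter_iff, Set.mem_preimage, Set.mem_singleton_iff, Set.mem_ofPred_eq]
    tauto
  · exact survivalAt_eq_zero hw

end

/-! ### The exit time bound on the cube and equality for subcubes -/

section

variable {n : ℕ} {Ω : Type*} [MeasurableSpace Ω] {μ : Measure Ω} {A : Finset (Fin n → Bool)}
  {X : ℕ → Ω → (Fin n → Bool)}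

/-- In dimension 0 the only vertex has no neighbour, so the first step would have total probability
0. -/
theorem IsSimpleRandomWalkFrom.cube_pos (hX : IsSimpleRandomWalkFrom (cubeGraph n) A μ X) :
    0 < n := by
  rcases Nat.eq_zero_or_pos n with rfl | h
  · have := hX.isProbabilityMeasure
    have h1 := hX.step 0 (fun _ => default) default
    have h2 : ∀ (i : ℕ) ω, X i ω = default := fun _ _ => Subsingleton.elim _ _
    simp [h2] at h1
  · exact h

theorem IsSimpleRandomWalkFrom.survivalAt_cube_succ
    (hX : IsSimpleRandomWalkFrom (cubeGraph n) A μ X) (k : ℕ) (x : Fin n → Bool) :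
    survivalAt μ X A (k + 1) x =
      if x ∈ A then (n : ℝ≥0∞)⁻¹ * ∑ i, survivalAt μ X A k (flipCoord i x) else 0 := by
  rw [hX.survivalAt_succ]
  congr 1
  rw [← sum_flipCoord_eq_sum_adj x (survivalAt μ X A k), Finset.mul_sum]
  refine Finset.sum_congr rfl fun y _ => ?_
  have hadj := (cubeGraph n).adj_comm x y
  rw [cubeGraph_degree]
  by_cases h : (cubeGraph n).Adj x y
  · rw [if_pos h, if_pos (hadj.1 h), mul_comm]
  · rw [if_neg h, if_neg fun h' => h (hadj.2 h'), mul_zero, mul_zero]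

theorem logb_cube_div_card (hA : A.Nonempty) :
    Real.logb 2 ((2 : ℝ) ^ n / (A.card : ℝ)) = n - Real.logb 2 A.card := by
  have hA' : (A.card : ℝ) ≠ 0 := by exact_mod_cast hA.card_pos.ne'
  rw [Real.logb_div (by positivity) hA', Real.logb_pow, Real.logb_self_eq_one (by norm_num),
    mul_one]

theorem IsSimpleRandomWalkFrom.meanFirstExitTime_le
    (hX : IsSimpleRandomWalkFrom (cubeGraph n) A μ X) :
    meanFirstExitTime μ X A ≤
      (n : ℝ≥0∞) / ENNReal.ofReal (Real.logb 2 ((2 : ℝ) ^ n / (A.card : ℝ))) := by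
  have hn := hX.cube_pos
  have := hX.isProbabilityMeasure
  rw [meanFirstExitTime_eq_tsum μ X hX.measurable, logb_cube_div_card hX.nonempty]
  rcases le_or_gt ((n : ℝ) - Real.logb 2 A.card) 0 with hd | hd
  -- Here the bound is `n / 0 = ⊤`, since `n ≠ 0`; this covers the full cube.
  · rw [ENNReal.ofReal_of_nonpos hd, ENNReal.div_zero (by exact_mod_cast hn.ne')]
    exact le_top
  have hfin : ∀ k x, survivalAt μ X A k x ≠ ⊤ := fun k x => measure_ne_top _ _
  refine ENNReal.tsum_le_of_sum_range_le fun N => ?_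
  have key := sum_killed_walk_mul_le hn hX.nonempty (fun k x => (survivalAt μ X A k x).toReal)
    (fun _ _ => ENNReal.toReal_nonneg)
    (fun x => by rw [hX.survivalAt_zero]; split_ifs <;> simp)
    (fun k x => by
      rw [hX.survivalAt_cube_succ]
      split_ifs
      · rw [ENNReal.toReal_mul, ENNReal.toReal_sum fun i _ => hfin k _]; simp
      · simp) N
  rw [← le_div_iff₀ hd] at key
  rw [← ENNReal.ofReal_natCast, ← ENNReal.ofReal_div_of_pos hd]
  refine le_trans (le_of_eq ?_) (ENNReal.ofReal_le_ofReal key)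
  rw [ENNReal.ofReal_sum_of_nonneg fun k _ => Finset.sum_nonneg fun x _ => ENNReal.toReal_nonneg]
  refine Finset.sum_congr rfl fun k _ => ?_
  rw [ENNReal.ofReal_sum_of_nonneg fun x _ => ENNReal.toReal_nonneg, ← hX.sum_survivalAt]
  exact Finset.sum_congr rfl fun x _ => (ENNReal.ofReal_toReal (hfin k x)).symm

theorem card_subcube {S : Finset (Fin n)} {z : Fin n → Bool}
    (h : ∀ x, x ∈ A ↔ ∀ i ∈ S, x i = z i) : A.card = 2 ^ Sᶜ.card := by
  have : A = Fintype.piFinset fun i => if i ∈ S then {z i} else Finset.univ := by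
    ext x
    rw [h, Fintype.mem_piFinset]
    refine forall_congr' fun i => ?_
    by_cases hi : i ∈ S <;> simp [hi]
  rw [this, Fintype.card_piFinset]
  simp only [apply_ite Finset.card, Finset.card_singleton, Finset.card_univ, Fintype.card_bool]
  rw [Finset.prod_ite]
  simp [Finset.filter_notMem_eq_sdiff, Finset.compl_eq_univ_sdiff]

theorem flipCoord_mem_subcube_iff {S : Finset (Fin n)} {z : Fin n → Bool}
    (h : ∀ x, x ∈ A ↔ ∀ i ∈ S, x i = z i) {x : Fin n → Bool} (hx : x ∈ A) (i : Fin n) :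
    flipCoord i x ∈ A ↔ i ∈ Sᶜ := by
  rw [h] at hx
  rw [h, Finset.mem_compl]
  constructor
  · intro H hi
    have := H i hi
    rw [← hx i hi] at this
    simp [flipCoord] at this
  · intro hi j hj
    rw [flipCoord, Function.update_of_ne (by rintro rfl; exact hi hj)]
    exact hx j hj

theorem IsSimpleRandomWalkFrom.measure_survival_subcube
    (hX : IsSimpleRandomWalkFrom (cubeGraph n) A μ X) {S : Finset (Fin n)} {z : Fin n → Bool}
    (h : ∀ x, x ∈ A ↔ ∀ i ∈ S, x i = z i) (k : ℕ) :
    μ {ω | ∀ i ≤ k, X i ω ∈ A} = ((n : ℝ≥0∞)⁻¹ * Sᶜ.card) ^ k := by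
  rw [← hX.sum_survivalAt]
  induction k with
  | zero =>
    have hA : (A.card : ℝ≥0∞) ≠ 0 := by exact_mod_cast hX.nonempty.card_pos.ne'
    simp only [hX.survivalAt_zero, Finset.sum_ite_mem, Finset.univ_inter, Finset.sum_const,
      nsmul_eq_mul, pow_zero]
    exact ENNReal.mul_inv_cancel hA (ENNReal.natCast_ne_top _)
  | succ k ih =>
    -- The double flip makes each summand a function of `flipCoord i x`, ready for reindexing by
    -- `sum_comp_flipCoord`. From a point of `A`, exactly the directions in `Sᶜ` stay in `A`, which
    -- yields one factor `Sᶜ.card / n` per step.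
    have h1 : ∀ x, survivalAt μ X A (k + 1) x = (n : ℝ≥0∞)⁻¹ *
        ∑ i, if flipCoord i (flipCoord i x) ∈ A then survivalAt μ X A k (flipCoord i x) else 0 := by
      intro x
      simp only [hX.survivalAt_cube_succ, flipCoord_flipCoord]
      split_ifs <;> simp
    have h2 : ∀ (i : Fin n) x, (if flipCoord i x ∈ A then survivalAt μ X A k x else 0) =
        if i ∈ Sᶜ then survivalAt μ X A k x else 0 := by
      intro i x
      by_cases hx : x ∈ A
      · simp only [flipCoord_mem_subcube_iff h hx]
      · simp [survivalAt_eq_zero hx]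
    have h3 : ∀ i : Fin n, ∑ x, (if flipCoord i (flipCoord i x) ∈ A then
        survivalAt μ X A k (flipCoord i x) else 0) =
        if i ∈ Sᶜ then ∑ x, survivalAt μ X A k x else 0 := by
      intro i
      rw [sum_comp_flipCoord i fun x => if flipCoord i x ∈ A then survivalAt μ X A k x else 0,
        Finset.sum_congr rfl fun x _ => h2 i x]
      split_ifs <;> simp
    simp only [h1]
    rw [← Finset.mul_sum, Finset.sum_comm, Finset.sum_congr rfl fun i _ => h3 i, ih,
      Finset.sum_ite_mem, Finset.univ_inter, Finset.sum_const, nsmul_eq_mul, pow_succ', mul_assoc]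

theorem IsSimpleRandomWalkFrom.meanFirstExitTime_subcube
    (hX : IsSimpleRandomWalkFrom (cubeGraph n) A μ X) (hA : IsSubcube A) :
    meanFirstExitTime μ X A =
      (n : ℝ≥0∞) / ENNReal.ofReal (Real.logb 2 ((2 : ℝ) ^ n / (A.card : ℝ))) := by
  obtain ⟨S, z, h⟩ := hA
  have hn : (n : ℝ≥0∞) ≠ 0 := by exact_mod_cast hX.cube_pos.ne'
  have hn' : (n : ℝ≥0∞) ≠ ⊤ := ENNReal.natCast_ne_top n
  have hST : S.card + Sᶜ.card = n := by rw [Finset.card_add_card_compl]; simp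
  have hlog : (n : ℝ) - Real.logb 2 A.card = S.card := by
    rw [card_subcube h]
    push_cast
    rw [Real.logb_pow, Real.logb_self_eq_one (by norm_num), mul_one, sub_eq_iff_eq_add]
    exact_mod_cast hST.symm
  have hsub : 1 - (n : ℝ≥0∞)⁻¹ * Sᶜ.card = (n : ℝ≥0∞)⁻¹ * S.card := by
    refine ENNReal.sub_eq_of_eq_add ?_ ?_
    · exact ENNReal.mul_ne_top (ENNReal.inv_ne_top.2 hn) (ENNReal.natCast_ne_top _)
    · rw [← mul_add, ← Nat.cast_add, hST, ENNReal.inv_mul_cancel hn hn']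
  -- Geometric series in `ℝ≥0∞`; for `S = ∅` the ratio is 1 and both sides are `⊤`.
  rw [meanFirstExitTime_eq_tsum μ X hX.measurable, logb_cube_div_card hX.nonempty, hlog,
    ENNReal.ofReal_natCast, tsum_congr fun k => hX.measure_survival_subcube h k,
    ENNReal.tsum_geometric, hsub, ENNReal.mul_inv (Or.inr (ENNReal.natCast_ne_top _))
      (Or.inl (ENNReal.inv_ne_top.2 hn)), inv_inv, div_eq_mul_inv]

end

theorem theorem1p2 {n : ℕ} {Ω : Type*} [MeasurableSpace Ω] (μ : Measure Ω)
    (A : Finset (Fin n → Bool)) (X : ℕ → Ω → (Fin n → Bool))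
    (hX : IsSimpleRandomWalkFrom (cubeGraph n) A μ X) :
    meanFirstExitTime μ X A ≤
        (n : ℝ≥0∞) / ENNReal.ofReal (Real.logb 2 ((2 : ℝ) ^ n / (A.card : ℝ))) ∧
    (IsSubcube A →
      meanFirstExitTime μ X A =
        (n : ℝ≥0∞) / ENNReal.ofReal (Real.logb 2 ((2 : ℝ) ^ n / (A.card : ℝ)))) ∧
    (∀ {Ω' : Type*} [MeasurableSpace Ω'] (ν : Measure Ω') (C : Finset (Fin n → Bool))
        (Z : ℕ → Ω' → (Fin n → Bool)),
      IsSimpleRandomWalkFrom (cubeGraph n) C ν Z → IsSubcube C → A.card = C.card →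
        meanFirstExitTime μ X A ≤ meanFirstExitTime ν Z C) := by
  refine ⟨hX.meanFirstExitTime_le, hX.meanFirstExitTime_subcube, ?_⟩
  intro Ω' _ ν C Z hZ hC hcard
  rw [hZ.meanFirstExitTime_subcube hC, ← hcard]
  exact hX.meanFirstExitTime_le
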